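/- Let $n\ge 1$ be an integer, $p\in(0,\infty)$, let $\mathbf U$ be a random vector in $\mathbb R^n$ and $\mathbf V$ a random variable on the same probability space, with values in an arbitrary measurable space (for instance $\mathbb R^n$). Let $|\cdot|$ be the Euclidean norm, $\log$ the logarithm in base $2$ with $\log 0=-\infty$, and \[ \|\mathbf U\|_p=\Big(\tfrac1n\,\mathbb E\big[\mathrm{Tr}^{p/2}(\mathbf U\mathbf U^T)\big]\Big)^{1/p}=\Big(\tfrac1n\,\mathbb E|\mathbf U|^p\Big)^{1/p},\qquad \mathrm{mmpe}(\mathbf U|\mathbf V;p)=\inf_f\|\mathbf U-f(\mathbf V)\|_p^p, \] the infimum being over all measurable functions $f$ with values in $\mathbb R^n$. The differential entropy $h(\mathbf U)=-\int g\log g\,dx$ is taken with respect to the Lebesgue density $g$ of $\mathbf U$, with $h(\mathbf U)=-\infty$ if the law of $\mathbf U$ is not absolutely continuous, and $h(\mathbf U|\mathbf V)=\int h(\mathbf U|\mathbf V=\mathbf v)\,dP_{\mathbf V}(\mathbf v)$, where $h(\mathbf U|\mathbf V=\mathbf v)$ is the differential entropy of the regular conditional law of $\mathbf U$ given $\mathbf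 V=\mathbf v$; all these quantities are extended real numbers. **Theorem.** If $h(\mathbf U)<\infty$ and $\|\mathbf U\|_p<\infty$, then $h(\mathbf U|\mathbf V)$ is well defined in $[-\infty,\infty)$ and \[ h(\mathbf U|\mathbf V)\le\frac n2\log\Big(k_{n,p}^2\cdot n^{2/p}\cdot \mathrm{mmpe}^{2/p}(\mathbf U|\mathbf V;p)\Big), \qquad k_{n,p}=\frac{\sqrt\pi\,\big(\tfrac pn\big)^{1/p}e^{1/p}\,\Gamma\big(\tfrac np+1\big)^{1/n}}{\Gamma\big(\tfrac n2+1\big)^{1/n}} . \] Moreover \[ k_{n,p}=\sqrt{2\pi e}\;\frac{1}{n^{1/2}\,(p/2)^{1/(2n)}}+o\Big(\frac np\Big)\qquad\text{as } \frac np\to\infty , \] jointly in the integers $n\ge1$ and the reals $p>0$. -/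

import Mathlib

open MeasureTheory ProbabilityTheory
open scoped ENNReal Asymptotics

/-- The extended-real integral `∫ f⁺ dμ - ∫ f⁻ dμ` of an extended-real valued function.
It is the usual integral whenever one of the two parts is finite. In the undefined case `∞ - ∞`
the value is `∞`, so that `extIntegral μ f < ∞` means that the integral exists in `[-∞, ∞)`. -/
noncomputable def extIntegral {α : Type*} [MeasurableSpace α] (μ : Measure α) (f : α → EReal) :
    EReal :=
  if ∫⁻ x, (f x).toENNReal ∂μ = ⊤ then ⊤
  else ((∫⁻ x, (f x).toENNReal ∂μ : ℝ≥0∞) : EReal) - ((∫⁻ x, (-f x).toENNReal ∂μ : ℝ≥0∞) : EReal)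

/-- Differential entropy (in bits) of a probability law `μ` on `ℝⁿ`: if `μ` has a Lebesgue density
`g`, it is `-∫ g(x) log₂ g(x) dx ∈ [-∞, ∞]`; if `μ` is not absolutely continuous with respect to
Lebesgue measure, it is `-∞` by the usual convention. -/
noncomputable def diffEntropy {n : ℕ} (μ : Measure (EuclideanSpace ℝ (Fin n))) : EReal :=
  open scoped Classical in
  if μ ≪ volume then
    extIntegral volume fun x =>
      ((-((μ.rnDeriv volume x).toReal * Real.logb 2 (μ.rnDeriv volume x).toReal) : ℝ) : EReal)
  else ⊥

/-- Conditional differential entropy `h(U | V) = ∫ h(U | V = v) dP_V(v)` (in bits), where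
`h(U | V = v)` is the differential entropy of the regular conditional law of `U` given `V = v`. -/
noncomputable def condDiffEntropy {Ω β : Type*} [MeasurableSpace Ω] [MeasurableSpace β]
    (P : Measure Ω) [IsProbabilityMeasure P] {n : ℕ}
    (U : Ω → EuclideanSpace ℝ (Fin n)) (V : Ω → β) : EReal :=
  extIntegral (P.map V) fun v => diffEntropy (condDistrib U V P v)

/-- The normalized `p`-norm `‖U‖_p = (n⁻¹ E[Tr(U Uᵀ)^(p/2)])^(1/p)` of a random vector in `ℝⁿ`,
with values in `[0, ∞]`; note `Tr(u uᵀ)^(p/2) = |u|^p` for the Euclidean norm `|u|`. -/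
noncomputable def pNorm {Ω : Type*} [MeasurableSpace Ω] (P : Measure Ω) {n : ℕ} (p : ℝ)
    (U : Ω → EuclideanSpace ℝ (Fin n)) : ℝ≥0∞ :=
  ((n : ℝ≥0∞)⁻¹ * ∫⁻ ω, ‖U ω‖ₑ ^ p ∂P) ^ (1 / p)

/-- Minimum mean `p`-th error `mmpe(U | V; p) = inf_f ‖U - f(V)‖_p ^ p` of estimating `U` from `V`,
the infimum being over all measurable functions `f`. -/
noncomputable def mmpe {Ω β : Type*} [MeasurableSpace Ω] [MeasurableSpace β]
    (P : Measure Ω) {n : ℕ} (U : Ω → EuclideanSpace ℝ (Fin n)) (V : Ω → β) (p : ℝ) : ℝ≥0∞ :=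
  ⨅ (f : β → EuclideanSpace ℝ (Fin n)) (_ : Measurable f),
    pNorm P p (fun ω => U ω - f (V ω)) ^ p

/-- The constant `k_{n,p}`. -/
noncomputable def kConst (n : ℕ) (p : ℝ) : ℝ :=
  √Real.pi * (p / n) ^ (1 / p) * Real.exp (1 / p) * Real.Gamma (n / p + 1) ^ (1 / (n : ℝ)) /
    Real.Gamma (n / 2 + 1) ^ (1 / (n : ℝ))

/-- The logarithm in base 2 on `[0, ∞]`, with `log₂ 0 = -∞` and `log₂ ∞ = ∞`. -/
noncomputable def extLogTwo (x : ℝ≥0∞) : EReal :=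
  ENNReal.log x / ((Real.log 2 : ℝ) : EReal)

/-!
By Gibbs' inequality against the density proportional to `exp (-c * |u - f v| ^ p)`, the entropy
`h(U | V = v)` is at most an affine function of the conditional moment `E[|U - f(V)| ^ p | V = v]`.
Averaging over `v` therefore gives the same bound with `E|U - f(V)| ^ p`, without Jensen's
inequality. When this moment is at most `n * t`, the best choice `c = 1 / (p * t)` produces exactly
the constant `k_{n,p}`. The infimum `mmpe` may vanish or fail to be attained, so the bound is
obtained for every `t > mmpe` and extended to `t = mmpe` by continuity.

For the asymptotics no cancellation is needed: by Stirling's formula and since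
`Γ(n / 2 + 1) ≥ 1 / 2`, both `k_{n,p}` and its approximant are `O(√(n / p))`, uniformly in `n`.
-/

section ExtIntegral

variable {α : Type*} [MeasurableSpace α] {μ : Measure α}

theorem extIntegral_mono_ae {f g : α → EReal} (h : f ≤ᵐ[μ] g) :
    extIntegral μ f ≤ extIntegral μ g := by
  have hpos : ∫⁻ x, (f x).toENNReal ∂μ ≤ ∫⁻ x, (g x).toENNReal ∂μ :=
    lintegral_mono_ae (h.mono fun _ hx => EReal.toENNReal_le_toENNReal hx)
  have hneg : ∫⁻ x, (-g x).toENNReal ∂μ ≤ ∫⁻ x, (-f x).toENNReal ∂μ :=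
    lintegral_mono_ae (h.mono fun _ hx =>
      EReal.toENNReal_le_toENNReal (EReal.neg_le_neg_iff.2 hx))
  unfold extIntegral
  by_cases hg : ∫⁻ x, (g x).toENNReal ∂μ = ⊤
  · simp only [hg, if_true, le_top]
  · rw [if_neg hg, if_neg (ne_top_of_le_ne_top hg hpos)]
    exact EReal.sub_le_sub (by exact_mod_cast hpos) (by exact_mod_cast hneg)

theorem extIntegral_coe {r : α → ℝ} (hr : Integrable r μ) :
    extIntegral μ (fun x => (r x : EReal)) = ((∫ x, r x ∂μ : ℝ) : EReal) := by
  have hpos : ∫⁻ x, ENNReal.ofReal (r x) ∂μ ≠ ⊤ := hr.lintegral_lt_top.ne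
  have hneg : ∫⁻ x, ENNReal.ofReal (-r x) ∂μ ≠ ⊤ := hr.neg.lintegral_lt_top.ne
  simp only [extIntegral, ← EReal.coe_neg, EReal.toENNReal_of_ne_top (EReal.coe_ne_top _),
    EReal.toReal_coe, if_neg hpos]
  rw [integral_eq_lintegral_pos_part_sub_lintegral_neg_part hr, EReal.coe_sub,
    EReal.coe_ennreal_toReal hpos, EReal.coe_ennreal_toReal hneg]

theorem extIntegral_le_integral {f : α → EReal} {r : α → ℝ} (hr : Integrable r μ)
    (h : ∀ᵐ x ∂μ, f x ≤ (r x : EReal)) : extIntegral μ f ≤ ((∫ x, r x ∂μ : ℝ) : EReal) :=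
  (extIntegral_mono_ae h).trans_eq (extIntegral_coe hr)

end ExtIntegral

section Gibbs

/-- The Fenchel–Young inequality between `g ↦ g * log g` and its conjugate `y ↦ exp (y - 1)`. -/
theorem neg_mul_log_le_mul_add_exp_neg_sub {g : ℝ} (hg : 0 ≤ g) (y : ℝ) :
    -(g * Real.log g) ≤ g * y + (Real.exp (-y) - g) := by
  rcases hg.eq_or_lt with rfl | hg
  · simpa using (Real.exp_pos (-y)).le
  · have htangent : -y - Real.log g + 1 ≤ Real.exp (-y) / g := by
      simpa only [Real.exp_sub, Real.exp_log hg] using Real.add_one_le_exp (-y - Real.log g)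
    rw [le_div_iff₀ hg] at htangent
    linarith

/-- Gibbs' variational principle; equality holds for the density `exp (-φ) / ∫ exp (-φ) ∂ν`. -/
theorem extIntegral_neg_rnDeriv_mul_logb_le {α : Type*} [MeasurableSpace α] {μ ν : Measure α}
    [IsProbabilityMeasure μ] [SigmaFinite ν] (hμν : μ ≪ ν) {b : ℝ} (hb : 1 < b) {φ : α → ℝ}
    (hφ : Integrable φ μ) (hexp : Integrable (fun x => Real.exp (-φ x)) ν) :
    extIntegral ν (fun x =>
        ((-((μ.rnDeriv ν x).toReal * Real.logb b (μ.rnDeriv ν x).toReal) : ℝ) : EReal)) ≤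
      (((Real.log (∫ x, Real.exp (-φ x) ∂ν) + ∫ x, φ x ∂μ) / Real.log b : ℝ) : EReal) := by
  set Z := ∫ x, Real.exp (-φ x) ∂ν
  set g := fun x => (μ.rnDeriv ν x).toReal
  have : NeZero ν := ⟨fun h => IsProbabilityMeasure.ne_zero μ
    (Measure.absolutelyContinuous_zero_iff.1 (h ▸ hμν))⟩
  have hZ : 0 < Z := integral_exp_pos hexp
  have hlogb : 0 < Real.log b := Real.log_pos hb
  have hg : Integrable g ν := Measure.integrable_toReal_rnDeriv
  have henergy : Integrable (fun x => φ x + Real.log Z) μ := hφ.add (integrable_const _)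
  have hg_energy : Integrable (fun x => g x * (φ x + Real.log Z)) ν :=
    (integrable_rnDeriv_smul_iff hμν).2 henergy
  have hgibbs : Integrable (fun x => Real.exp (-φ x) / Z - g x) ν := (hexp.div_const Z).sub hg
  have hpointwise (x : α) : -(g x * Real.logb b (g x)) ≤
      (g x * (φ x + Real.log Z) + (Real.exp (-φ x) / Z - g x)) / Real.log b := by
    rw [Real.logb, ← mul_div_assoc, ← neg_div]
    gcongr
    simpa only [neg_add, Real.exp_add, Real.exp_neg (Real.log Z), Real.exp_log hZ, div_eq_mul_inv]
      using neg_mul_log_le_mul_add_exp_neg_sub (g := g x) ENNReal.toReal_nonneg (φ x + Real.log Z)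
  have hintegral_energy : ∫ x, g x * (φ x + Real.log Z) ∂ν = Real.log Z + ∫ x, φ x ∂μ :=
    calc ∫ x, g x * (φ x + Real.log Z) ∂ν
      _ = ∫ x, (φ x + Real.log Z) ∂μ := integral_rnDeriv_smul hμν
      _ = Real.log Z + ∫ x, φ x ∂μ := by
        rw [integral_add hφ (integrable_const _), integral_const, probReal_univ, one_smul, add_comm]
  have hintegral_gibbs : ∫ x, (Real.exp (-φ x) / Z - g x) ∂ν = 0 := by
    rw [integral_sub (hexp.div_const Z) hg, integral_div, div_self hZ.ne',
      Measure.integral_toReal_rnDeriv hμν, probReal_univ, sub_self]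
  refine (extIntegral_le_integral ((hg_energy.add hgibbs).div_const _)
    (ae_of_all _ fun x => EReal.coe_le_coe_iff.2 (hpointwise x))).trans_eq ?_
  simp only [Pi.add_apply]
  rw [integral_div, integral_add hg_energy hgibbs, hintegral_energy, hintegral_gibbs, add_zero]

theorem diffEntropy_le_log_integral_exp_neg {n : ℕ} {μ : Measure (EuclideanSpace ℝ (Fin n))}
    [IsProbabilityMeasure μ] {φ : EuclideanSpace ℝ (Fin n) → ℝ} (hφ : Integrable φ μ)
    (hexp : Integrable fun x => Real.exp (-φ x)) :
    diffEntropy μ ≤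
      (((Real.log (∫ x, Real.exp (-φ x)) + ∫ x, φ x ∂μ) / Real.log 2 : ℝ) : EReal) := by
  unfold diffEntropy
  split_ifs with hμ
  · exact extIntegral_neg_rnDeriv_mul_logb_le hμ one_lt_two hφ hexp
  · exact bot_le

end Gibbs

section GeneralizedGaussian

variable {E : Type*} [NormedAddCommGroup E] [NormedSpace ℝ E] [FiniteDimensional ℝ E]
  [MeasurableSpace E] [BorelSpace E] (μ : Measure E) [μ.IsAddHaarMeasure] {p c : ℝ}

theorem integral_exp_neg_norm_rpow (hp : 0 < p) :
    ∫ x, Real.exp (-‖x‖ ^ p) ∂μ =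
      μ.real (Metric.ball 0 1) * Real.Gamma (Module.finrank ℝ E / p + 1) := by
  have hΓ : 0 < Real.Gamma (Module.finrank ℝ E / p + 1) := Real.Gamma_pos_of_pos (by positivity)
  rw [measureReal_def, measure_unitBall_eq_integral_div_gamma μ hp,
    ENNReal.toReal_ofReal (by positivity), div_mul_cancel₀ _ hΓ.ne']

theorem integral_exp_neg_mul_norm_rpow (hp : 0 < p) (hc : 0 < c) :
    ∫ x, Real.exp (-(c * ‖x‖ ^ p)) ∂μ = c ^ (-(Module.finrank ℝ E / p)) *
      (μ.real (Metric.ball 0 1) * Real.Gamma (Module.finrank ℝ E / p + 1)) := by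
  have hscale (x : E) : c * ‖x‖ ^ p = ‖c ^ (1 / p) • x‖ ^ p := by
    rw [norm_smul, Real.norm_of_nonneg (by positivity),
      Real.mul_rpow (by positivity) (norm_nonneg x), ← Real.rpow_mul hc.le,
      one_div_mul_cancel hp.ne', Real.rpow_one]
  simp_rw [hscale]
  rw [Measure.integral_comp_smul μ fun x : E => Real.exp (-‖x‖ ^ p),
    integral_exp_neg_norm_rpow μ hp, abs_of_nonneg (by positivity), smul_eq_mul,
    ← Real.rpow_mul_natCast hc.le, ← Real.rpow_neg hc.le, one_div_mul_eq_div]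

theorem integrable_exp_neg_mul_norm_rpow (hp : 0 < p) (hc : 0 < c) :
    Integrable (fun x => Real.exp (-(c * ‖x‖ ^ p))) μ := by
  refine .of_integral_ne_zero (ne_of_gt ?_)
  have hball : 0 < μ.real (Metric.ball (0 : E) 1) :=
    ENNReal.toReal_pos (Metric.measure_ball_pos μ 0 one_pos).ne' measure_ball_lt_top.ne
  rw [integral_exp_neg_mul_norm_rpow μ hp hc]
  positivity

end GeneralizedGaussian

section Entropy

theorem integral_integral_condDistrib {Ω α β F : Type*} [MeasurableSpace Ω] [MeasurableSpace α]
    [StandardBorelSpace α] [Nonempty α] [MeasurableSpace β] [NormedAddCommGroup F]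
    [NormedSpace ℝ F] {P : Measure Ω} [IsFiniteMeasure P] {X : Ω → α} {Y : Ω → β}
    (hX : AEMeasurable X P) (hY : AEMeasurable Y P) {φ : β × α → F}
    (hφ : Integrable φ (P.map fun ω => (Y ω, X ω))) :
    ∫ y, ∫ x, φ (y, x) ∂condDistrib X Y P y ∂P.map Y = ∫ ω, φ (Y ω, X ω) ∂P := by
  rw [← integral_map (hY.prodMk hX) hφ.aestronglyMeasurable, ← compProd_map_condDistrib hX]
  exact (Measure.integral_compProd (by rwa [compProd_map_condDistrib hX])).symm

variable {n : ℕ} {p c : ℝ}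

theorem diffEntropy_le_of_integrable_norm_sub_rpow {μ : Measure (EuclideanSpace ℝ (Fin n))}
    [IsProbabilityMeasure μ] (hp : 0 < p) (hc : 0 < c) {a : EuclideanSpace ℝ (Fin n)}
    (hμ : Integrable (fun x => ‖x - a‖ ^ p) μ) :
    diffEntropy μ ≤
      (((Real.log (∫ x : EuclideanSpace ℝ (Fin n), Real.exp (-(c * ‖x‖ ^ p))) +
        c * ∫ x, ‖x - a‖ ^ p ∂μ) / Real.log 2 : ℝ) : EReal) := by
  have h := diffEntropy_le_log_integral_exp_neg (hμ.const_mul c)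
    ((integrable_exp_neg_mul_norm_rpow volume hp hc).comp_sub_right a)
  rwa [integral_sub_right_eq_self
    (fun x : EuclideanSpace ℝ (Fin n) => Real.exp (-(c * ‖x‖ ^ p))) a, integral_const_mul] at h

theorem condDiffEntropy_le_of_integrable_norm_sub_rpow {Ω β : Type*} [MeasurableSpace Ω]
    [MeasurableSpace β] {P : Measure Ω} [IsProbabilityMeasure P] (hp : 0 < p) (hc : 0 < c)
    {U : Ω → EuclideanSpace ℝ (Fin n)} (hU : AEMeasurable U P) {V : Ω → β}
    (hV : AEMeasurable V P) {f : β → EuclideanSpace ℝ (Fin n)} (hf : Measurable f)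
    (hfint : Integrable (fun ω => ‖U ω - f (V ω)‖ ^ p) P) :
    condDiffEntropy P U V ≤
      (((Real.log (∫ x : EuclideanSpace ℝ (Fin n), Real.exp (-(c * ‖x‖ ^ p))) +
        c * ∫ ω, ‖U ω - f (V ω)‖ ^ p ∂P) / Real.log 2 : ℝ) : EReal) := by
  set A := Real.log (∫ x : EuclideanSpace ℝ (Fin n), Real.exp (-(c * ‖x‖ ^ p)))
  set err : β × EuclideanSpace ℝ (Fin n) → ℝ := fun z => ‖z.2 - f z.1‖ ^ p
  have : IsProbabilityMeasure (P.map V) := Measure.isProbabilityMeasure_map hV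
  have herr : Integrable err (P.map fun ω => (V ω, U ω)) :=
    (integrable_map_measure (Measurable.aestronglyMeasurable (by fun_prop))
      (hV.prodMk hU)).2 hfint
  have hcondErr : Integrable (fun v => ∫ u, err (v, u) ∂condDistrib U V P v) (P.map V) :=
    herr.integral_condDistrib_map hU
  have hbound : ∀ᵐ v ∂P.map V, diffEntropy (condDistrib U V P v) ≤
      (((A + c * ∫ u, err (v, u) ∂condDistrib U V P v) / Real.log 2 : ℝ) : EReal) := by
    filter_upwards [herr.condDistrib_ae_map hU] with v hv
    exact diffEntropy_le_of_integrable_norm_sub_rpow (a := f v) hp hc hv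
  have hboundInt : Integrable
      (fun v => (A + c * ∫ u, err (v, u) ∂condDistrib U V P v) / Real.log 2) (P.map V) :=
    ((integrable_const A).add (hcondErr.const_mul c)).div_const _
  refine (extIntegral_le_integral hboundInt hbound).trans_eq ?_
  rw [integral_div, integral_add (integrable_const A) (hcondErr.const_mul c), integral_const,
    probReal_univ, one_smul, integral_const_mul, integral_integral_condDistrib hU hV herr]

end Entropy

section Constant

variable {n : ℕ} {p : ℝ}

/-- With `x = n / p`, this isolates the Stirling ratio `Γ(x + 1) / (x / e) ^ x`. -/
theorem kConst_eq_sqrt_pi_mul_rpow (hn : n ≠ 0) (hp : 0 < p) :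
    kConst n p = √Real.pi * (Real.Gamma (n / p + 1) / (n / p / Real.exp 1) ^ (n / p) /
      Real.Gamma (n / 2 + 1)) ^ (1 / (n : ℝ)) := by
  have hΓp : 0 < Real.Gamma (n / p + 1) := Real.Gamma_pos_of_pos (by positivity)
  have hΓ2 : 0 < Real.Gamma ((n : ℝ) / 2 + 1) := Real.Gamma_pos_of_pos (by positivity)
  have hroot : ((n / p / Real.exp 1) ^ (n / p)) ^ (1 / (n : ℝ)) =
      ((p / n) ^ (1 / p) * Real.exp (1 / p))⁻¹ := by
    rw [← Real.rpow_mul (by positivity), div_mul_div_comm, mul_one, mul_comm p,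
      div_mul_cancel_left₀ (by positivity), ← one_div,
      Real.div_rpow (by positivity) (by positivity), Real.exp_one_rpow, ← inv_div p,
      Real.inv_rpow (by positivity), mul_inv, div_eq_mul_inv]
  rw [Real.div_rpow (by positivity) hΓ2.le, Real.div_rpow hΓp.le (by positivity), hroot, kConst]
  field_simp

theorem kConst_pos (hn : n ≠ 0) (hp : 0 < p) : 0 < kConst n p := by
  rw [kConst_eq_sqrt_pi_mul_rpow hn hp]
  positivity

theorem volume_real_unitBall_euclideanSpace (hn : n ≠ 0) :
    volume.real (Metric.ball (0 : EuclideanSpace ℝ (Fin n)) 1) =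
      √Real.pi ^ n / Real.Gamma (n / 2 + 1) := by
  have : NeZero n := ⟨hn⟩
  rw [measureReal_def, EuclideanSpace.volume_ball, Fintype.card_fin, ENNReal.ofReal_one, one_pow,
    one_mul, ENNReal.toReal_ofReal (by positivity)]

theorem integral_exp_neg_inv_mul_norm_rpow_mul_exp (hn : n ≠ 0) (hp : 0 < p) {t : ℝ}
    (ht : 0 < t) :
    (∫ x : EuclideanSpace ℝ (Fin n), Real.exp (-((p * t)⁻¹ * ‖x‖ ^ p))) * Real.exp (n / p) =
      (kConst n p * (n * t) ^ (1 / p)) ^ n := by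
  have hscale : (p * t) ^ (n / p) * Real.exp (n / p) =
      (n * t) ^ (n / p) / (n / p / Real.exp 1) ^ (n / p) := by
    rw [← Real.exp_one_rpow, ← Real.mul_rpow (by positivity) (by positivity),
      ← Real.div_rpow (by positivity) (by positivity)]
    congr 1
    field_simp
  rw [integral_exp_neg_mul_norm_rpow volume hp (by positivity), finrank_euclideanSpace_fin,
    volume_real_unitBall_euclideanSpace hn, Real.rpow_neg (by positivity),
    Real.inv_rpow (by positivity), inv_inv, mul_right_comm, hscale,
    kConst_eq_sqrt_pi_mul_rpow hn hp, mul_pow, mul_pow, ← Real.rpow_mul_natCast (by positivity),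
    ← Real.rpow_mul_natCast (by positivity), one_div_mul_cancel (by positivity), Real.rpow_one,
    one_div_mul_eq_div]
  ring

end Constant

section MaxEntropyBound

variable {n : ℕ} {p : ℝ}

/-- The largest differential entropy of a law on `ℝⁿ` whose `p`-th absolute moment, normalized by
the factor `1 / n`, is at most `t`. -/
noncomputable def maxEntropyBound (n : ℕ) (p : ℝ) (t : ℝ≥0∞) : EReal :=
  (((n : ℝ) / 2 : ℝ) : EReal) *
    extLogTwo (ENNReal.ofReal (kConst n p ^ 2 * (n : ℝ) ^ (2 / p)) * t ^ (2 / p))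

theorem extLogTwo_ofReal_of_pos {x : ℝ} (hx : 0 < x) :
    extLogTwo (ENNReal.ofReal x) = (Real.logb 2 x : EReal) := by
  rw [extLogTwo, ENNReal.log_ofReal_of_pos hx, ← EReal.coe_div, Real.logb]

theorem continuous_extLogTwo : Continuous extLogTwo := by
  have hmul : extLogTwo = fun x => (((Real.log 2)⁻¹ : ℝ) : EReal) * ENNReal.log x :=
    funext fun x => by rw [extLogTwo, EReal.div_eq_inv_mul, EReal.coe_inv]
  rw [hmul]
  exact continuous_iff_continuousAt.2 fun x => EReal.Tendsto.const_mul
    ENNReal.continuous_log.continuousAt (Or.inl (EReal.coe_ne_bot _))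
    (Or.inl (EReal.coe_ne_top _))

theorem extLogTwo_top : extLogTwo ⊤ = ⊤ := by
  rw [extLogTwo, ENNReal.log_top, EReal.top_div_of_pos_ne_top
    (EReal.coe_pos.2 (Real.log_pos one_lt_two)) (EReal.coe_ne_top _)]

theorem continuous_maxEntropyBound (n : ℕ) (p : ℝ) : Continuous (maxEntropyBound n p) := by
  have hcont : Continuous fun t : ℝ≥0∞ =>
      extLogTwo (ENNReal.ofReal (kConst n p ^ 2 * (n : ℝ) ^ (2 / p)) * t ^ (2 / p)) :=
    continuous_extLogTwo.comp
      ((ENNReal.continuous_const_mul ENNReal.ofReal_ne_top).comp ENNReal.continuous_rpow_const)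
  exact continuous_iff_continuousAt.2 fun t => EReal.Tendsto.const_mul hcont.continuousAt
    (Or.inl (EReal.coe_ne_bot _)) (Or.inl (EReal.coe_ne_top _))

theorem maxEntropyBound_top (hn : n ≠ 0) (hp : 0 < p) : maxEntropyBound n p ⊤ = ⊤ := by
  have hk := kConst_pos hn hp
  have hcoeff : ENNReal.ofReal (kConst n p ^ 2 * (n : ℝ) ^ (2 / p)) ≠ 0 := by
    rw [ENNReal.ofReal_ne_zero_iff]
    positivity
  rw [maxEntropyBound, ENNReal.top_rpow_of_pos (by positivity), ENNReal.mul_top hcoeff,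
    extLogTwo_top, EReal.coe_mul_top_of_pos (by positivity)]

theorem maxEntropyBound_ofReal (hn : n ≠ 0) (hp : 0 < p) {t : ℝ} (ht : 0 < t) :
    maxEntropyBound n p (ENNReal.ofReal t) =
      (((Real.log (∫ x : EuclideanSpace ℝ (Fin n), Real.exp (-((p * t)⁻¹ * ‖x‖ ^ p))) +
        (p * t)⁻¹ * (n * t)) / Real.log 2 : ℝ) : EReal) := by
  have hk := kConst_pos hn hp
  have hradius : kConst n p ^ 2 * (n : ℝ) ^ (2 / p) * t ^ (2 / p) =
      (kConst n p * (n * t) ^ (1 / p)) ^ 2 := by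
    rw [mul_assoc, ← Real.mul_rpow (by positivity) ht.le, mul_pow,
      ← Real.rpow_mul_natCast (by positivity), Nat.cast_ofNat, one_div_mul_eq_div]
  have hexponent : (p * t)⁻¹ * (n * t) = n / p := by field_simp
  have hZ : 0 < ∫ x : EuclideanSpace ℝ (Fin n), Real.exp (-((p * t)⁻¹ * ‖x‖ ^ p)) :=
    integral_exp_pos (integrable_exp_neg_mul_norm_rpow volume hp (by positivity))
  have hlog : Real.log (∫ x : EuclideanSpace ℝ (Fin n), Real.exp (-((p * t)⁻¹ * ‖x‖ ^ p))) +
      n / p = n * Real.log (kConst n p * (n * t) ^ (1 / p)) := by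
    rw [← Real.log_exp (n / p), ← Real.log_mul hZ.ne' (Real.exp_ne_zero _),
      integral_exp_neg_inv_mul_norm_rpow_mul_exp hn hp ht, Real.log_pow]
  rw [maxEntropyBound, ENNReal.ofReal_rpow_of_pos ht, ← ENNReal.ofReal_mul (by positivity), hradius,
    extLogTwo_ofReal_of_pos (by positivity), hexponent, hlog, ← EReal.coe_mul,
    ← Real.log_div_log, Real.log_pow]
  congr 1
  push_cast
  ring

variable {Ω β : Type*} [MeasurableSpace Ω] [MeasurableSpace β] {P : Measure Ω}
  {U : Ω → EuclideanSpace ℝ (Fin n)} {V : Ω → β}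

theorem pNorm_rpow (hp : 0 < p) : pNorm P p U ^ p = (n : ℝ≥0∞)⁻¹ * ∫⁻ ω, ‖U ω‖ₑ ^ p ∂P := by
  rw [pNorm, ← ENNReal.rpow_mul, one_div_mul_cancel hp.ne', ENNReal.rpow_one]

theorem exists_integral_norm_sub_rpow_le_of_mmpe_lt (hn : n ≠ 0) (hp : 0 < p)
    (hU : AEMeasurable U P) (hV : AEMeasurable V P) {t : ℝ} (ht : 0 < t)
    (hmmpe : mmpe P U V p < ENNReal.ofReal t) :
    ∃ f : β → EuclideanSpace ℝ (Fin n), Measurable f ∧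
      Integrable (fun ω => ‖U ω - f (V ω)‖ ^ p) P ∧ ∫ ω, ‖U ω - f (V ω)‖ ^ p ∂P ≤ n * t := by
  simp only [mmpe, iInf_lt_iff] at hmmpe
  obtain ⟨f, hf, hlt⟩ := hmmpe
  rw [pNorm_rpow hp, ← ENNReal.div_eq_inv_mul] at hlt
  have hle : ∫⁻ ω, ‖‖U ω - f (V ω)‖ ^ p‖ₑ ∂P ≤ ENNReal.ofReal (n * t) := by
    simp only [Real.enorm_rpow_of_nonneg (norm_nonneg _) hp.le, enorm_norm]
    rw [ENNReal.ofReal_mul (by positivity), ENNReal.ofReal_natCast, mul_comm]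
    exact (ENNReal.div_le_iff (by exact_mod_cast hn) (ENNReal.natCast_ne_top n)).1 hlt.le
  have hint : Integrable (fun ω => ‖U ω - f (V ω)‖ ^ p) P :=
    ⟨((hU.sub (hf.comp_aemeasurable hV)).norm.pow_const p).aestronglyMeasurable,
      hle.trans_lt ENNReal.ofReal_lt_top⟩
  refine ⟨f, hf, hint, (ENNReal.ofReal_le_ofReal_iff (by positivity)).1 ?_⟩
  rwa [ofReal_integral_eq_lintegral_ofReal hint (ae_of_all _ fun ω => by positivity),
    ← lintegral_enorm_of_nonneg fun ω => by positivity]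

theorem condDiffEntropy_le_maxEntropyBound_of_mmpe_lt [IsProbabilityMeasure P] (hn : n ≠ 0)
    (hp : 0 < p) (hU : AEMeasurable U P) (hV : AEMeasurable V P) {t : ℝ≥0∞}
    (hmmpe : mmpe P U V p < t) : condDiffEntropy P U V ≤ maxEntropyBound n p t := by
  obtain rfl | ht := eq_or_ne t ⊤
  · exact le_top.trans_eq (maxEntropyBound_top hn hp).symm
  have ht0 : 0 < t.toReal := ENNReal.toReal_pos hmmpe.ne_bot ht
  rw [← ENNReal.ofReal_toReal ht] at hmmpe ⊢
  obtain ⟨f, hf, hint, hle⟩ :=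
    exists_integral_norm_sub_rpow_le_of_mmpe_lt hn hp hU hV ht0 hmmpe
  rw [maxEntropyBound_ofReal hn hp ht0]
  refine (condDiffEntropy_le_of_integrable_norm_sub_rpow hp (c := (p * t.toReal)⁻¹)
    (by positivity) hU hV hf hint).trans (EReal.coe_le_coe_iff.2 ?_)
  gcongr

theorem condDiffEntropy_le_maxEntropyBound_mmpe [IsProbabilityMeasure P] (hn : n ≠ 0)
    (hp : 0 < p) (hU : AEMeasurable U P) (hV : AEMeasurable V P) :
    condDiffEntropy P U V ≤ maxEntropyBound n p (mmpe P U V p) := by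
  obtain hmmpe | hmmpe := eq_or_ne (mmpe P U V p) ⊤
  · rw [hmmpe, maxEntropyBound_top hn hp]
    exact le_top
  have : (nhdsWithin (mmpe P U V p) (Set.Ioi (mmpe P U V p))).NeBot :=
    nhdsGT_neBot_of_exists_gt ⟨⊤, hmmpe.lt_top⟩
  refine ge_of_tendsto ((continuous_maxEntropyBound n p).continuousWithinAt
    (s := Set.Ioi (mmpe P U V p)) (x := mmpe P U V p)) ?_
  filter_upwards [self_mem_nhdsWithin] with t ht
  exact condDiffEntropy_le_maxEntropyBound_of_mmpe_lt hn hp hU hV ht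

end MaxEntropyBound

section Asymptotics

theorem half_le_Gamma {y : ℝ} (hy : 0 < y) : 1 / 2 ≤ Real.Gamma y := by
  have hmono {z : ℝ} (hz : 2 ≤ z) : 1 ≤ Real.Gamma z := by
    simpa only [Real.Gamma_two] using
      Real.Gamma_strictMonoOn_Ici.monotoneOn Set.self_mem_Ici hz hz
  rcases le_total 2 y with h2y | hy2
  · linarith [hmono h2y]
  rcases le_total 1 y with h1y | hy1
  · have hstep := hmono (z := y + 1) (by linarith)
    rw [Real.Gamma_add_one hy.ne'] at hstep
    nlinarith [Real.Gamma_pos_of_pos hy]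
  · have hstep := hmono (z := y + 1 + 1) (by linarith)
    rw [Real.Gamma_add_one (by positivity), Real.Gamma_add_one hy.ne'] at hstep
    nlinarith [mul_pos hy (Real.Gamma_pos_of_pos hy), Real.Gamma_pos_of_pos hy]

theorem factorial_le_exp_one_mul_sqrt_mul_pow {n : ℕ} (hn : n ≠ 0) :
    (n.factorial : ℝ) ≤ Real.exp 1 * √n * (n / Real.exp 1) ^ n := by
  obtain ⟨m, rfl⟩ := Nat.exists_eq_succ_of_ne_zero hn
  have hanti := Stirling.stirlingSeq'_antitone (Nat.zero_le m)
  simp only [Function.comp_apply, Nat.succ_eq_add_one, zero_add, Stirling.stirlingSeq_one]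
    at hanti ⊢
  rw [Stirling.stirlingSeq, div_le_iff₀ (by positivity), Real.sqrt_mul zero_le_two] at hanti
  refine hanti.trans_eq ?_
  field_simp

theorem Gamma_add_le_Gamma_mul_rpow {y θ : ℝ} (hy : 0 < y) (hθ : 0 ≤ θ) (hθ1 : θ ≤ 1) :
    Real.Gamma (y + θ) ≤ Real.Gamma y * y ^ θ := by
  have hΓ := Real.Gamma_pos_of_pos hy
  have hconv := Real.convexOn_log_Gamma.2 (Set.mem_Ioi.2 hy) (Set.mem_Ioi.2 (by positivity))
    (sub_nonneg.2 hθ1) hθ (sub_add_cancel 1 θ) (y := y + 1)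
  simp only [Function.comp_apply, smul_eq_mul] at hconv
  rw [show (1 - θ) * y + θ * (y + 1) = y + θ by ring, Real.Gamma_add_one hy.ne',
    Real.log_mul hy.ne' hΓ.ne'] at hconv
  rw [← Real.log_le_log_iff (Real.Gamma_pos_of_pos (by positivity)) (by positivity),
    Real.log_mul hΓ.ne' (by positivity), Real.log_rpow hy]
  linarith

theorem Gamma_add_one_le_mul_sqrt_mul_rpow {x : ℝ} (hx : 1 ≤ x) :
    Real.Gamma (x + 1) ≤ 2 * Real.exp 1 ^ 2 * √x * (x / Real.exp 1) ^ x := by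
  have hx0 : 0 < x := one_pos.trans_le hx
  set m : ℕ := ⌊x⌋₊
  have hm : m ≠ 0 := (Nat.floor_pos.2 hx).ne'
  have hmx : (m : ℝ) ≤ x := Nat.floor_le hx0.le
  have hxm : x < m + 1 := Nat.lt_floor_add_one x
  have hfactorial : (m.factorial : ℝ) ≤ Real.exp 1 * √x * (x / Real.exp 1) ^ m :=
    (factorial_le_exp_one_mul_sqrt_mul_pow hm).trans (by gcongr)
  have hfraction : ((m : ℝ) + 1) ^ (x - m) ≤ 2 * Real.exp 1 * (x / Real.exp 1) ^ (x - m) :=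
    calc ((m : ℝ) + 1) ^ (x - m)
      _ ≤ (2 * Real.exp 1 * (x / Real.exp 1)) ^ (x - m) := by
        have : 2 * Real.exp 1 * (x / Real.exp 1) = 2 * x := by field_simp
        gcongr
        linarith
      _ = (2 * Real.exp 1) ^ (x - m) * (x / Real.exp 1) ^ (x - m) :=
        Real.mul_rpow (by positivity) (by positivity)
      _ ≤ 2 * Real.exp 1 * (x / Real.exp 1) ^ (x - m) := by
        gcongr
        exact Real.rpow_le_self_of_one_le (by linarith [Real.add_one_le_exp 1]) (by linarith)
  calc Real.Gamma (x + 1)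
    _ = Real.Gamma (m + 1 + (x - m)) := by ring_nf
    _ ≤ Real.Gamma (m + 1) * ((m : ℝ) + 1) ^ (x - m) :=
      Gamma_add_le_Gamma_mul_rpow (by positivity) (by linarith) (by linarith)
    _ = m.factorial * ((m : ℝ) + 1) ^ (x - m) := by rw [Real.Gamma_nat_eq_factorial]
    _ ≤ Real.exp 1 * √x * (x / Real.exp 1) ^ m *
        (2 * Real.exp 1 * (x / Real.exp 1) ^ (x - m)) := by gcongr
    _ = 2 * Real.exp 1 ^ 2 * √x * ((x / Real.exp 1) ^ m * (x / Real.exp 1) ^ (x - m)) := by ring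
    _ = 2 * Real.exp 1 ^ 2 * √x * (x / Real.exp 1) ^ x := by
      rw [← Real.rpow_natCast (x / Real.exp 1) m, ← Real.rpow_add (by positivity), add_sub_cancel]

theorem kConst_le_mul_sqrt {n : ℕ} {p : ℝ} (hn : n ≠ 0) (hp : 0 < p) (hx : 1 ≤ n / p) :
    kConst n p ≤ √Real.pi * (4 * Real.exp 1 ^ 2) * √(n / p) := by
  have hn1 : (1 : ℝ) ≤ n := by exact_mod_cast Nat.one_le_iff_ne_zero.2 hn
  have hΓ2 : 1 / 2 ≤ Real.Gamma ((n : ℝ) / 2 + 1) := half_le_Gamma (by positivity)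
  have hratio : Real.Gamma (n / p + 1) / (n / p / Real.exp 1) ^ (n / p) /
      Real.Gamma (n / 2 + 1) ≤ 4 * Real.exp 1 ^ 2 * √(n / p) := by
    rw [div_le_iff₀ (by positivity), div_le_iff₀ (by positivity)]
    refine (Gamma_add_one_le_mul_sqrt_mul_rpow hx).trans ?_
    nlinarith [mul_le_mul_of_nonneg_left hΓ2 (show 0 ≤ 4 * Real.exp 1 ^ 2 * √(n / p) *
      (n / p / Real.exp 1) ^ (n / p) by positivity)]
  have hone : 1 ≤ 4 * Real.exp 1 ^ 2 * √(n / p) :=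
    one_le_mul_of_one_le_of_one_le (by nlinarith [Real.add_one_le_exp 1]) (Real.one_le_sqrt.2 hx)
  rw [kConst_eq_sqrt_pi_mul_rpow hn hp, mul_assoc (√Real.pi)]
  gcongr
  exact (Real.rpow_le_rpow (by positivity) hratio (by positivity)).trans
    (Real.rpow_le_self_of_one_le hone ((div_le_one₀ (by positivity)).2 hn1))

theorem one_div_sqrt_mul_rpow_le_sqrt {n : ℕ} {p : ℝ} (hn : n ≠ 0) (hp : 0 < p)
    (hx : 1 ≤ n / p) :
    1 / ((n : ℝ) ^ (1 / 2 : ℝ) * (p / 2) ^ (1 / (2 * (n : ℝ)))) ≤ √2 * √(n / p) := by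
  have hn1 : (1 : ℝ) ≤ n := by exact_mod_cast Nat.one_le_iff_ne_zero.2 hn
  have hle : 2 / p ≤ 2 * (n / p) := by
    rw [mul_div_assoc']
    gcongr
    linarith
  calc 1 / ((n : ℝ) ^ (1 / 2 : ℝ) * (p / 2) ^ (1 / (2 * (n : ℝ))))
    _ ≤ 1 / (1 * (p / 2) ^ (1 / (2 * (n : ℝ)))) := by
      gcongr
      exact Real.one_le_rpow hn1 (by positivity)
    _ = (2 / p) ^ (1 / (2 * (n : ℝ))) := by
      rw [one_mul, one_div, ← Real.inv_rpow (by positivity), inv_div]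
    _ ≤ (2 * (n / p)) ^ (1 / (2 * (n : ℝ))) := by gcongr
    _ ≤ (2 * (n / p)) ^ (1 / 2 : ℝ) := by
      gcongr
      · linarith
      · linarith
    _ = √2 * √(n / p) := by rw [← Real.sqrt_eq_rpow, Real.sqrt_mul zero_le_two]

theorem sqrt_isLittleO_id_atTop : Real.sqrt =o[Filter.atTop] (id : ℝ → ℝ) := by
  have hone : (fun _ : ℝ => (1 : ℝ)) =o[Filter.atTop] Real.sqrt :=
    Asymptotics.isLittleO_const_left.2
      (Or.inr (tendsto_norm_atTop_atTop.comp Real.tendsto_sqrt_atTop))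
  refine (hone.mul_isBigO (Asymptotics.isBigO_refl Real.sqrt Filter.atTop)).congr'
    (.of_forall fun x => one_mul _) ?_
  filter_upwards [Filter.eventually_ge_atTop 0] with x hx using Real.mul_self_sqrt hx

theorem eventually_comap_div_atTop :
    ∀ᶠ q : ℕ × ℝ in Filter.comap (fun q : ℕ × ℝ => (q.1 : ℝ) / q.2) Filter.atTop,
      q.1 ≠ 0 ∧ 0 < q.2 ∧ 1 ≤ (q.1 : ℝ) / q.2 := by
  filter_upwards [Filter.tendsto_comap.eventually (Filter.eventually_ge_atTop 1)] with q hq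
  have hpos : 0 < (q.1 : ℝ) / q.2 := one_pos.trans_le hq
  refine ⟨fun hn => ?_, ?_, hq⟩
  · rw [hn, Nat.cast_zero, zero_div] at hpos
    exact hpos.false
  · by_contra! hp
    exact hpos.not_ge (div_nonpos_of_nonneg_of_nonpos (Nat.cast_nonneg _) hp)

theorem kConst_sub_isBigO_sqrt :
    (fun q : ℕ × ℝ => kConst q.1 q.2 -
        √(2 * Real.pi * Real.exp 1) *
          (1 / ((q.1 : ℝ) ^ (1 / 2 : ℝ) * (q.2 / 2) ^ (1 / (2 * (q.1 : ℝ))))))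
      =O[Filter.comap (fun q : ℕ × ℝ => (q.1 : ℝ) / q.2) Filter.atTop]
        (fun q : ℕ × ℝ => √((q.1 : ℝ) / q.2)) := by
  refine .sub (.of_bound (√Real.pi * (4 * Real.exp 1 ^ 2)) ?_)
    (.const_mul_left (.of_bound √2 ?_) _)
  · filter_upwards [eventually_comap_div_atTop] with q ⟨hn, hp, hq⟩
    rw [Real.norm_of_nonneg (kConst_pos hn hp).le, Real.norm_of_nonneg (Real.sqrt_nonneg _)]
    exact kConst_le_mul_sqrt hn hp hq
  · filter_upwards [eventually_comap_div_atTop] with q ⟨hn, hp, hq⟩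
    rw [Real.norm_of_nonneg (by positivity), Real.norm_of_nonneg (Real.sqrt_nonneg _)]
    exact one_div_sqrt_mul_rpow_le_sqrt hn hp hq

end Asymptotics

theorem mainTheorem1_general {Ω β : Type*} [MeasurableSpace Ω] [MeasurableSpace β]
    (P : Measure Ω) [IsProbabilityMeasure P] (n : ℕ) (hn : 1 ≤ n) (p : ℝ) (hp : 0 < p)
    (U : Ω → EuclideanSpace ℝ (Fin n)) (hU : AEMeasurable U P) (V : Ω → β)
    (hV : AEMeasurable V P) :
    condDiffEntropy P U V ≤
        (((n : ℝ) / 2 : ℝ) : EReal) *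
          extLogTwo (ENNReal.ofReal (kConst n p ^ 2 * (n : ℝ) ^ (2 / p)) *
            mmpe P U V p ^ (2 / p)) ∧
      (fun q : ℕ × ℝ => kConst q.1 q.2 -
          √(2 * Real.pi * Real.exp 1) *
            (1 / ((q.1 : ℝ) ^ (1 / 2 : ℝ) * (q.2 / 2) ^ (1 / (2 * (q.1 : ℝ))))))
        =O[Filter.comap (fun q : ℕ × ℝ => (q.1 : ℝ) / q.2) Filter.atTop]
          (fun q : ℕ × ℝ => √((q.1 : ℝ) / q.2)) :=
  ⟨condDiffEntropy_le_maxEntropyBound_mmpe (Nat.one_le_iff_ne_zero.1 hn) hp hU hV,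
    kConst_sub_isBigO_sqrt⟩

theorem mainTheorem1 {Ω β : Type*} [MeasurableSpace Ω] [MeasurableSpace β]
    (P : Measure Ω) [IsProbabilityMeasure P] (n : ℕ) (hn : 1 ≤ n) (p : ℝ) (hp : 0 < p)
    (U : Ω → EuclideanSpace ℝ (Fin n)) (hU : Measurable U) (V : Ω → β) (hV : Measurable V)
    (hh : diffEntropy (P.map U) < ⊤) (hm : pNorm P p U < ⊤) :
    condDiffEntropy P U V ≤
        (((n : ℝ) / 2 : ℝ) : EReal) *
          extLogTwo (ENNReal.ofReal (kConst n p ^ 2 * (n : ℝ) ^ (2 / p)) *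
            mmpe P U V p ^ (2 / p)) ∧
      (fun q : ℕ × ℝ => kConst q.1 q.2 -
          √(2 * Real.pi * Real.exp 1) *
            (1 / ((q.1 : ℝ) ^ (1 / 2 : ℝ) * (q.2 / 2) ^ (1 / (2 * (q.1 : ℝ))))))
        =o[Filter.comap (fun q : ℕ × ℝ => (q.1 : ℝ) / q.2) Filter.atTop]
          (fun q : ℕ × ℝ => (q.1 : ℝ) / q.2) := by
  obtain ⟨hbound, hasymp⟩ := mainTheorem1_general P n hn p hp U hU.aemeasurable V hV.aemeasurable
  exact ⟨hbound, hasymp.trans_isLittleO (sqrt_isLittleO_id_atTop.comp_tendsto Filter.tendsto_comap)⟩
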